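/- Let $m,n,\ell$ be positive integers. For $a=(\tau,i)$ in $\mathbb Z_{\ge 0}^m\times\{0,\dots,n-1\}$ put $\deg a=\tau_1+\dots+\tau_m$, and write $(\tau,i)\le(\eta,j)$ if $i=j$ and $\tau_r\le\eta_r$ for all $r=1,\dots,m$. An antichain sequence is a finite sequence $a_1,\dots,a_k$ in $\mathbb Z_{\ge 0}^m\times\{0,\dots,n-1\}$ such that $a_i\not\le a_j$ for all $i\ne j$; its degree growth is bounded by $f:\mathbb Z_{\ge 0}\to\mathbb Z_{\ge 0}$ if $\deg a_i\le f(i)$ for all $1\le i\le k$. Let $A$ be the Ackermann function: $A(0,q)=q+1$, $A(p+1,0)=A(p,1)$ and $A(p+1,q+1)=A(p,A(p+1,q))$ for $p,q\ge 0$. Let $f(i)=2^i\ell$. Then the lengths of the antichain sequences in $\mathbb Z_{\ge 0}^m\times\{0,\dots,n-1\}$ with degree growth bounded by $f$ have a maximum $\mathfrak L=\mathfrak L_{\ell,m}^n$, and the number $T=T(m,n,\ell)=2^{\mathfrak L+1}\ell$ (the constant that appears in the effective differential Nullstellensatz for $m$ commuting derivations, $n$ differential indeterminates and order at most $\ell$)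 satisfies $$T<2\,A(m+3,4\ell-1)\quad\text{if } n=1,\qquad\qquad T<\frac{2}{n}\,A(m+5,4n\ell-1)\quad\text{if } n>1.$$ -/

import Mathlib

/-- The order on `ℕ^m × n`: `(τ, i) ≤ (η, j)` iff `i = j` and `τ ≤ η` in the product order of
`ℕ^m`. (This is not the Mathlib product order, which would also compare `i` and `j`.) -/
def TupleLE {m n : ℕ} (a b : (Fin m → ℕ) × Fin n) : Prop :=
  a.2 = b.2 ∧ ∀ r, a.1 r ≤ b.1 r

/-- The degree of `(τ, i)` is `τ_1 + ⋯ + τ_m`. -/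
def tupleDeg {m n : ℕ} (a : (Fin m → ℕ) × Fin n) : ℕ :=
  ∑ r, a.1 r

/-- A finite sequence is Dicksonian if no term is below a later one. -/
def IsDicksonianSeq {m n k : ℕ} (a : Fin k → (Fin m → ℕ) × Fin n) : Prop :=
  ∀ i j, i < j → ¬ TupleLE (a i) (a j)

/-- An antichain sequence is a Dicksonian sequence in which no term is above a later one. -/
def IsAntichainSeq {m n k : ℕ} (a : Fin k → (Fin m → ℕ) × Fin n) : Prop :=
  IsDicksonianSeq a ∧ ∀ i j, i < j → ¬ TupleLE (a j) (a i)

/-- The degree growth of `a_1, …, a_k` is bounded by `f`: `deg a_i ≤ f i` for `1 ≤ i ≤ k`.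
The term `a_i` of the mathematical sequence is `a ⟨i - 1, _⟩` here. -/
def DegreeGrowthBoundedBy {m n k : ℕ} (f : ℕ → ℕ) (a : Fin k → (Fin m → ℕ) × Fin n) : Prop :=
  ∀ i : Fin k, tupleDeg (a i) ≤ f ((i : ℕ) + 1)

/-- The lengths of the antichain sequences of `ℕ^m × n` with degree growth bounded by `f`. -/
def antichainSeqLengths (f : ℕ → ℕ) (m n : ℕ) : Set ℕ :=
  {k | ∃ a : Fin k → (Fin m → ℕ) × Fin n, IsAntichainSeq a ∧ DegreeGrowthBoundedBy f a}

/-- The maximal length of an antichain sequence of `ℕ^m × n` with degree growth bounded by `f`. -/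
noncomputable def maxAntichainLength (f : ℕ → ℕ) (m n : ℕ) : ℕ :=
  sSup (antichainSeqLengths f m n)

/-- `T(m, n, ℓ) = 2 ^ (L + 1) * ℓ`, where `L` is the maximal length of an antichain sequence of
`ℕ^m × n` with degree growth bounded by `i ↦ 2 ^ i * ℓ`. -/
noncomputable def nullstellensatzT (m n ℓ : ℕ) : ℕ :=
  2 ^ (maxAntichainLength (fun i => 2 ^ i * ℓ) m n + 1) * ℓ

/-! Cover the terms still to come by faces of `ℕ^m`, each given by fixing some coordinates. If the
next term `x` lies in a face `r`, every later term in `r` has a free coordinate below that of `x`.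
So `r` gives way to at most `deg x ≤ v` faces of one dimension less, while the degree bound `v`
doubles. `descentBound` is a potential that this exchange does not increase
(`descentBound_exchange`) and that is always at least `v`. Starting from the single face `ℕ^m`, this
bounds `2 ^ k * v` by `stepBound m v`, which two applications of `ack (m + 2)` dominate. Several
copies of `ℕ^m` reduce to one copy of `ℕ^(m+2)`. -/

/-- An upper bound for the value reached by a quantity that starts at `v` and doubles with every
term of a bad sequence in `ℕ^k` whose degrees it controls. -/
def stepBound : ℕ → ℕ → ℕ
  | 0, v => 2 * v
  | k + 1, v => (stepBound k)^[v + 1] (2 * v)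

/-- The corresponding bound for a disjoint union of `c j` copies of `ℕ^j`, `j < k`. -/
def descentBound (c : ℕ → ℕ) : ℕ → ℕ → ℕ
  | 0, v => v
  | k + 1, v => (stepBound k)^[c k] (descentBound c k v)

/-! ### The potential function -/

theorem stepBound_monotone (k : ℕ) : Monotone (stepBound k) := by
  induction k with
  | zero => intro v w h; simp only [stepBound]; omega
  | succ k ih =>
    have two : ∀ x, x ≤ stepBound k x := by
      clear ih
      induction k with
      | zero => intro x; simp only [stepBound]; omega
      | succ k ih =>
        intro x
        have := Function.id_le_iterate_of_id_le (f := stepBound k) ih (x + 1) (2 * x)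
        simp only [stepBound, id] at this ⊢
        omega
    intro v w h
    simp only [stepBound]
    calc (stepBound k)^[v + 1] (2 * v) ≤ (stepBound k)^[v + 1] (2 * w) :=
          ih.iterate _ (by omega)
      _ ≤ (stepBound k)^[w + 1] (2 * w) :=
          Function.monotone_iterate_of_id_le two (by omega) _

theorem two_mul_le_stepBound (k v : ℕ) : 2 * v ≤ stepBound k v := by
  induction k generalizing v with
  | zero => exact le_rfl
  | succ k ih =>
    exact Function.id_le_iterate_of_id_le (f := stepBound k)
      (fun x => (Nat.le_mul_of_pos_left x two_pos).trans (ih x)) (v + 1) (2 * v)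

theorem id_le_stepBound (k : ℕ) : id ≤ stepBound k := fun v =>
  (Nat.le_mul_of_pos_left v two_pos).trans (two_mul_le_stepBound k v)

theorem stepBound_iterate_le {k i j v w : ℕ} (hij : i ≤ j) (hvw : v ≤ w) :
    (stepBound k)^[i] v ≤ (stepBound k)^[j] w :=
  ((stepBound_monotone k).iterate i hvw).trans
    (Function.monotone_iterate_of_id_le (id_le_stepBound k) hij w)

theorem stepBound_le_succ (k v : ℕ) : stepBound k v ≤ stepBound (k + 1) v :=
  stepBound_iterate_le (k := k) (i := 1) (by omega) (by omega)

theorem le_descentBound (c : ℕ → ℕ) (k v : ℕ) : v ≤ descentBound c k v := by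
  induction k with
  | zero => exact le_rfl
  | succ k ih => exact stepBound_iterate_le (i := 0) (Nat.zero_le _) ih

theorem descentBound_mono {c d : ℕ → ℕ} {k : ℕ} (h : ∀ j < k, c j ≤ d j) (v : ℕ) :
    descentBound c k v ≤ descentBound d k v := by
  induction k with
  | zero => exact le_rfl
  | succ k ih =>
    exact stepBound_iterate_le (h k (by omega)) (ih fun j hj => h j (by omega))

theorem descentBound_two_mul_le (c : ℕ → ℕ) (k v : ℕ) :
    descentBound c k (2 * v) ≤ stepBound k (descentBound c k v) := by
  induction k with
  | zero => exact le_rfl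
  | succ k ih =>
    calc (stepBound k)^[c k] (descentBound c k (2 * v))
        ≤ (stepBound k)^[c k] (stepBound k (descentBound c k v)) :=
          stepBound_iterate_le le_rfl ih
      _ = stepBound k (descentBound c (k + 1) v) := by
          rw [← Function.iterate_succ_apply, Function.iterate_succ_apply', descentBound]
      _ ≤ _ := stepBound_le_succ _ _

/-- Trading one copy of `ℕ^k` for at most `v` copies of `ℕ^(k-1)` while doubling `v` does not
increase the bound. -/
theorem descentBound_exchange {c d : ℕ → ℕ} {k K v : ℕ} (hk : k < K) (hd : d k + 1 ≤ c k)
    (hpred : ∀ j, j + 1 = k → d j ≤ c j + v) (hne : ∀ j, j ≠ k → j + 1 ≠ k → d j ≤ c j) :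
    descentBound d K (2 * v) ≤ descentBound c K v := by
  induction K, hk using Nat.le_induction with
  | succ K hK ih => exact stepBound_iterate_le (hne K (by omega) (by omega)) ih
  | base =>
    -- The one `stepBound k` released by the spent copy pays for both the doubling and the new
    -- copies.
    have key : descentBound d k (2 * v) ≤ stepBound k (descentBound c k v) := by
      cases k with
      | zero => exact le_rfl
      | succ j =>
        set w := descentBound c (j + 1) v with hw
        calc (stepBound j)^[d j] (descentBound d j (2 * v))
            ≤ (stepBound j)^[v + c j] (descentBound c j (2 * v)) :=
              stepBound_iterate_le (by have := hpred j rfl; omega)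
                (descentBound_mono (fun i hi => hne i (by omega) (by omega)) _)
          _ ≤ (stepBound j)^[v + c j] (stepBound j (descentBound c j v)) :=
              stepBound_iterate_le le_rfl (descentBound_two_mul_le c j v)
          _ = (stepBound j)^[v + 1] w := by
              rw [hw, descentBound, ← Function.iterate_succ_apply, ← Function.iterate_add_apply]
              congr 1; omega
          -- Of the `v + 1` iterations, `v` serve the new copies and one the doubling; `v ≤ w` makes
          -- `w + 1` enough.
          _ ≤ (stepBound j)^[w + 1] (2 * w) :=
              stepBound_iterate_le (by have := le_descentBound c (j + 1) v; omega) (by omega)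
    calc (stepBound k)^[d k] (descentBound d k (2 * v))
        ≤ (stepBound k)^[d k] (stepBound k (descentBound c k v)) :=
          stepBound_iterate_le le_rfl key
      _ = (stepBound k)^[d k + 1] (descentBound c k v) := rfl
      _ ≤ _ := stepBound_iterate_le hd le_rfl

/-! ### Covering bad sequences by faces -/

/-- The number of coordinates left free by a partial assignment. -/
def freeDim {m : ℕ} (r : Fin m → Option ℕ) : ℕ :=
  (Finset.univ.filter fun t => r t = none).card

/-- The point `x` agrees with the partial assignment `r`. -/
def MatchesAssignment {m : ℕ} (r : Fin m → Option ℕ) (x : Fin m → ℕ) : Prop :=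
  ∀ t v, r t = some v → x t = v

/-- The partial assignments that fix one more free coordinate `t` of `r`, to a value below `x t`. -/
def refinements {m : ℕ} (r : Fin m → Option ℕ) (x : Fin m → ℕ) : Finset (Fin m → Option ℕ) :=
  (Finset.univ.filter fun t => r t = none).biUnion fun t =>
    (Finset.range (x t)).image fun s => Function.update r t (some s)

theorem card_refinements_le {m : ℕ} (r : Fin m → Option ℕ) (x : Fin m → ℕ) :
    (refinements r x).card ≤ ∑ t, x t := by
  calc (refinements r x).card
      ≤ ∑ t ∈ Finset.univ.filter (fun t => r t = none),
          ((Finset.range (x t)).image fun s => Function.update r t (some s)).card :=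
        Finset.card_biUnion_le
    _ ≤ ∑ t ∈ Finset.univ.filter (fun t => r t = none), x t :=
        Finset.sum_le_sum fun t _ => Finset.card_image_le.trans (Finset.card_range _).le
    _ ≤ ∑ t, x t := Finset.sum_le_sum_of_subset (Finset.filter_subset _ _)

theorem freeDim_of_mem_refinements {m : ℕ} {r q : Fin m → Option ℕ} {x : Fin m → ℕ}
    (h : q ∈ refinements r x) : freeDim q + 1 = freeDim r := by
  simp only [refinements, Finset.mem_biUnion, Finset.mem_image, Finset.mem_filter,
    Finset.mem_univ, true_and] at h
  obtain ⟨t, ht, s, -, rfl⟩ := h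
  have : (Finset.univ.filter fun u => Function.update r t (some s) u = none) =
      (Finset.univ.filter fun u => r u = none).erase t := by
    ext u
    by_cases hu : u = t <;> simp [hu, Function.update_apply]
  rw [freeDim, this, freeDim, Finset.card_erase_add_one (by simpa using ht)]

theorem exists_refinement {m : ℕ} {r : Fin m → Option ℕ} {x y : Fin m → ℕ}
    (hx : MatchesAssignment r x) (hy : MatchesAssignment r y) (hxy : ¬ x ≤ y) :
    ∃ q ∈ refinements r x, MatchesAssignment q y := by
  obtain ⟨t, ht⟩ : ∃ t, y t < x t := by simpa [Pi.le_def] using hxy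
  -- Two points of the same face agree on its fixed coordinates.
  have hr : r t = none := by
    rcases h : r t with _ | v
    · rfl
    · rw [hx t v h, hy t v h] at ht
      exact absurd ht (lt_irrefl _)
  refine ⟨Function.update r t (some (y t)), ?_, fun u v hv => ?_⟩
  · simp only [refinements, Finset.mem_biUnion, Finset.mem_image, Finset.mem_filter,
      Finset.mem_univ, true_and, Finset.mem_range]
    exact ⟨t, hr, y t, ht, rfl⟩
  · by_cases hu : u = t
    · subst hu; simpa using hv
    · rw [Function.update_of_ne hu] at hv
      exact hy u v hv

/-- The number of members of `S` with `j` free coordinates. -/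
def freeDimCount {m : ℕ} (S : Finset (Fin m → Option ℕ)) (j : ℕ) : ℕ :=
  (S.filter fun r => freeDim r = j).card

/-- Induction on the length: dropping the first term replaces its face by the refinements and `v` by
`2 * v`. -/
theorem two_pow_mul_le_descentBound {m k v : ℕ} {a : Fin k → Fin m → ℕ}
    {S : Finset (Fin m → Option ℕ)} (hS : ∀ i, ∃ r ∈ S, MatchesAssignment r (a i))
    (hbad : ∀ i j, i < j → ¬ a i ≤ a j) (hdeg : ∀ i : Fin k, ∑ t, a i t ≤ 2 ^ (i : ℕ) * v) :
    2 ^ k * v ≤ descentBound (freeDimCount S) (m + 1) v := by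
  induction k generalizing v S with
  | zero => simpa using le_descentBound _ _ v
  | succ k ih =>
    obtain ⟨r, hrS, hr⟩ := hS 0
    have hstep := ih (v := 2 * v) (a := fun i => a i.succ) (S := S.erase r ∪ refinements r (a 0))
      (fun i => by
        obtain ⟨q, hqS, hq⟩ := hS i.succ
        by_cases hqr : q = r
        · subst hqr
          obtain ⟨p, hp, hpa⟩ := exists_refinement hr hq (hbad 0 i.succ i.succ_pos)
          exact ⟨p, Finset.mem_union_right _ hp, hpa⟩
        · exact ⟨q, Finset.mem_union_left _ (Finset.mem_erase.2 ⟨hqr, hqS⟩), hq⟩)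
      (fun i j hij => hbad _ _ (Fin.succ_lt_succ_iff.2 hij))
      (fun i => by
        have := hdeg i.succ
        rw [Fin.val_succ, pow_succ, mul_assoc] at this
        exact this)
    have hcount : ∀ j, freeDimCount (S.erase r ∪ refinements r (a 0)) j ≤
        ((S.filter fun q => freeDim q = j).erase r).card +
          ((refinements r (a 0)).filter fun q => freeDim q = j).card := fun j => by
      rw [freeDimCount, Finset.filter_union, Finset.filter_erase]
      exact Finset.card_union_le _ _
    have hempty : ∀ j, j + 1 ≠ freeDim r →
        ((refinements r (a 0)).filter fun q => freeDim q = j).card = 0 := fun j hj => by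
      rw [Finset.card_eq_zero, Finset.filter_eq_empty_iff]
      intro q hq hqj
      exact hj (hqj ▸ freeDim_of_mem_refinements hq)
    refine le_trans (by rw [pow_succ, mul_assoc]) (hstep.trans
      (descentBound_exchange (k := freeDim r) ?_ ?_ ?_ ?_))
    · exact Nat.lt_succ_of_le ((Finset.card_filter_le _ _).trans (by simp))
    · have h1 := hcount (freeDim r)
      rw [hempty _ (by omega)] at h1
      have h2 : ((S.filter fun q => freeDim q = freeDim r).erase r).card + 1 =
          freeDimCount S (freeDim r) :=
        Finset.card_erase_add_one (Finset.mem_filter.2 ⟨hrS, rfl⟩)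
      omega
    · intro j _
      refine (hcount j).trans (Nat.add_le_add (Finset.card_le_card (Finset.erase_subset _ _)) ?_)
      exact (Finset.card_filter_le _ _).trans ((card_refinements_le _ _).trans
        (by simpa using hdeg 0))
    · intro j _ hj
      have h1 := hcount j
      rw [hempty j hj] at h1
      exact h1.trans (Finset.card_le_card (Finset.erase_subset _ _))

theorem descentBound_of_forall_eq_zero {c : ℕ → ℕ} {k : ℕ} (h : ∀ j < k, c j = 0) (v : ℕ) :
    descentBound c k v = v := by
  induction k with
  | zero => rfl
  | succ k ih =>
    rw [descentBound, h k (by omega), ih fun j hj => h j (by omega), Function.iterate_zero_apply]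

theorem two_pow_mul_le_stepBound {m k v : ℕ} {a : Fin k → Fin m → ℕ}
    (hbad : ∀ i j, i < j → ¬ a i ≤ a j) (hdeg : ∀ i : Fin k, ∑ t, a i t ≤ 2 ^ (i : ℕ) * v) :
    2 ^ k * v ≤ stepBound m v := by
  have h := two_pow_mul_le_descentBound (S := {fun _ => none})
    (fun i => ⟨_, Finset.mem_singleton_self _, fun t v hv => by simp at hv⟩) hbad hdeg
  have hfree : freeDim (fun _ : Fin m => (none : Option ℕ)) = m := by simp [freeDim]
  have hzero : ∀ j < m, freeDimCount {fun _ : Fin m => (none : Option ℕ)} j = 0 := fun j hj => by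
    rw [freeDimCount, Finset.filter_singleton, if_neg (by omega), Finset.card_empty]
  have hone : freeDimCount {fun _ : Fin m => (none : Option ℕ)} m = 1 := by
    rw [freeDimCount, Finset.filter_singleton, if_pos hfree, Finset.card_singleton]
  rwa [descentBound, hone, descentBound_of_forall_eq_zero hzero, Function.iterate_one] at h

/-! ### Comparison with the Ackermann function -/

theorem stepBound_le_ack_ack (k v : ℕ) : stepBound k v ≤ ack (k + 2) (ack (k + 2) v) := by
  induction k generalizing v with
  | zero => simp only [stepBound, zero_add, ack_two]; omega
  | succ k ih =>
    -- Each `stepBound k` costs two applications of `ack (k + 2)`, which raise the argument of `ack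
    -- (k + 3)` by 2.
    have iter : ∀ i x q, x ≤ ack (k + 3) q → (stepBound k)^[i] x ≤ ack (k + 3) (q + 2 * i) := by
      intro i x q hx
      induction i with
      | zero => exact hx
      | succ i ihi =>
        rw [Function.iterate_succ_apply']
        calc stepBound k ((stepBound k)^[i] x)
            ≤ stepBound k (ack (k + 3) (q + 2 * i)) := stepBound_monotone k ihi
          _ ≤ ack (k + 2) (ack (k + 2) (ack (k + 3) (q + 2 * i))) := ih _
          _ = ack (k + 3) (q + 2 * (i + 1)) := by
              rw [show q + 2 * (i + 1) = q + 2 * i + 1 + 1 by ring, ack_succ_succ (k + 2),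
                ack_succ_succ (k + 2)]
    have h2 : 2 * v ≤ ack (k + 3) v :=
      calc 2 * v ≤ ack 2 v := by rw [ack_two]; omega
        _ ≤ _ := ack_mono_left _ (by omega)
    have h3 : v + 2 * (v + 1) ≤ ack (k + 3) v := by
      refine le_trans ?_ (ack_mono_left v (show 3 ≤ k + 3 by omega))
      simp only [ack_three]
      have : v < 2 ^ v := Nat.lt_two_pow_self
      rw [pow_add]
      omega
    exact (iter (v + 1) (2 * v) v h2).trans (ack_mono_right _ h3)

/-- The Ackermannian length bound for bad sequences in `ℕ^m` of exponential degree growth. -/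
theorem two_pow_mul_lt_two_mul_ack {m k l : ℕ} (hl : 1 ≤ l) {a : Fin k → Fin m → ℕ}
    (hbad : ∀ i j, i < j → ¬ a i ≤ a j)
    (hdeg : ∀ i : Fin k, ∑ t, a i t ≤ 2 ^ ((i : ℕ) + 1) * l) :
    2 ^ (k + 1) * l < 2 * ack (m + 3) (4 * l - 1) := by
  have h1 := two_pow_mul_le_stepBound (v := 2 * l) hbad
    (fun i => by simpa only [pow_succ, mul_assoc] using hdeg i)
  -- The argument `4 * l - 3` leaves room for the two increments that `stepBound m` costs.
  have h2 : 2 * l ≤ ack (m + 3) (4 * l - 3) := by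
    have := lt_ack_right (m + 3) (4 * l - 3)
    omega
  have h3 : stepBound m (2 * l) ≤ ack (m + 3) (4 * l - 1) := by
    refine (stepBound_monotone m h2).trans ((stepBound_le_ack_ack m _).trans ?_)
    rw [show 4 * l - 1 = 4 * l - 3 + 1 + 1 by omega, ack_succ_succ (m + 2), ack_succ_succ (m + 2)]
  have h4 := ack_pos (m + 3) (4 * l - 1)
  rw [pow_succ, mul_assoc]
  omega

/-! ### Antichains in copies of `ℕ^m` -/

theorem two_pow_mul_lt_of_mem_lengths_one {m k l : ℕ} (hl : 1 ≤ l)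
    (hk : k ∈ antichainSeqLengths (fun i => 2 ^ i * l) m 1) :
    2 ^ (k + 1) * l < 2 * ack (m + 3) (4 * l - 1) := by
  obtain ⟨a, ⟨ha, -⟩, hdeg⟩ := hk
  exact two_pow_mul_lt_two_mul_ack hl (a := fun i => (a i).1)
    (fun i j hij h => ha i j hij ⟨Subsingleton.elim _ _, h⟩) hdeg

/-- `n` copies of `ℕ^m` embed in `ℕ^(m+2)` by sending the index `i` to `(i, n - 1 - i)`. -/
theorem two_pow_mul_lt_of_mem_lengths {m n k l : ℕ} (hn : 1 ≤ n) (hl : 1 ≤ l)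
    (hk : k ∈ antichainSeqLengths (fun i => 2 ^ i * l) m n) :
    2 ^ (k + 1) * (n * l) < 2 * ack (m + 5) (4 * (n * l) - 1) := by
  obtain ⟨a, ⟨ha, -⟩, hdeg⟩ := hk
  refine two_pow_mul_lt_two_mul_ack (m := m + 2) (Nat.mul_pos hn hl)
    (a := fun i => Fin.cons ((a i).2 : ℕ) (Fin.cons (n - 1 - ((a i).2 : ℕ)) (a i).1))
    (fun i j hij h => ha i j hij ⟨?_, fun r => ?_⟩) (fun i => ?_)
  -- Comparability of both `i` and `n - 1 - i` forces the indices to be equal.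
  · have h0 := h 0
    have h1 := h 1
    rw [← Fin.succ_zero_eq_one] at h1
    simp only [Fin.cons_zero, Fin.cons_succ] at h0 h1
    have := (a i).2.isLt
    have := (a j).2.isLt
    exact Fin.ext (by omega)
  · simpa using h r.succ.succ
  -- The two new coordinates add `n - 1` to the degree; a bound `D ≥ 1` absorbs this as `n - 1 + D ≤
  -- n * D`.
  · have h1 : ∑ t, (a i).1 t ≤ 2 ^ ((i : ℕ) + 1) * l := hdeg i
    have h2 : 1 ≤ 2 ^ ((i : ℕ) + 1) * l := Nat.mul_pos (by positivity) hl
    have := (a i).2.isLt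
    rw [Fin.sum_univ_succ, Fin.sum_univ_succ]
    simp only [Fin.cons_zero, Fin.cons_succ]
    obtain ⟨n, rfl⟩ : ∃ p, n = p + 1 := ⟨n - 1, by omega⟩
    have h3 : 2 ^ ((i : ℕ) + 1) * ((n + 1) * l) =
        n * (2 ^ ((i : ℕ) + 1) * l) + 2 ^ ((i : ℕ) + 1) * l := by ring
    have h4 := Nat.mul_le_mul_left n h2
    omega

theorem isGreatest_maxAntichainLength {m n l : ℕ} (hn : 1 ≤ n) (hl : 1 ≤ l) :
    IsGreatest (antichainSeqLengths (fun i => 2 ^ i * l) m n)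
      (maxAntichainLength (fun i => 2 ^ i * l) m n) := by
  have hbdd : BddAbove (antichainSeqLengths (fun i => 2 ^ i * l) m n) := by
    refine ⟨2 * ack (m + 5) (4 * (n * l) - 1), fun k hk => ?_⟩
    have h1 : k + 1 < 2 ^ (k + 1) := Nat.lt_two_pow_self
    have h2 : 2 ^ (k + 1) ≤ 2 ^ (k + 1) * (n * l) :=
      Nat.le_mul_of_pos_right _ (Nat.mul_pos hn hl)
    have h3 := two_pow_mul_lt_of_mem_lengths hn hl hk
    omega
  have hne : (antichainSeqLengths (fun i => 2 ^ i * l) m n).Nonempty :=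
    ⟨0, fun i => i.elim0, ⟨fun i => i.elim0, fun i => i.elim0⟩, fun i => i.elim0⟩
  exact ⟨Nat.sSup_mem hne hbdd, fun k hk => le_csSup hbdd hk⟩

theorem mainTheorem5 (m n ℓ : ℕ) (hm : 1 ≤ m) (hn : 1 ≤ n) (hℓ : 1 ≤ ℓ) :
    IsGreatest (antichainSeqLengths (fun i => 2 ^ i * ℓ) m n)
      (maxAntichainLength (fun i => 2 ^ i * ℓ) m n) ∧
    (n = 1 → nullstellensatzT m n ℓ < 2 * ack (m + 3) (4 * ℓ - 1)) ∧
    (1 < n →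
      (nullstellensatzT m n ℓ : ℝ) < (2 / (n : ℝ)) * (ack (m + 5) (4 * n * ℓ - 1) : ℝ)) := by
  have hmax := isGreatest_maxAntichainLength (m := m) hn hℓ
  refine ⟨hmax, ?_, fun _ => ?_⟩
  · rintro rfl
    exact two_pow_mul_lt_of_mem_lengths_one hℓ hmax.1
  · have h : n * nullstellensatzT m n ℓ < 2 * ack (m + 5) (4 * n * ℓ - 1) := by
      have := two_pow_mul_lt_of_mem_lengths hn hℓ hmax.1
      rwa [mul_left_comm, ← mul_assoc 4] at this
    have hpos : (0 : ℝ) < n := by exact_mod_cast hn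
    rw [div_mul_eq_mul_div, lt_div_iff₀ hpos, mul_comm]
    exact_mod_cast h
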